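/- Let $\mathbb K$ be a field and let $\nu:\mathbb K[x]\to\Gamma\cup\{\infty\}$ be a valuation with values in a totally ordered abelian group $\Gamma$ (that is, $\nu(fg)=\nu(f)+\nu(g)$, $\nu(f+g)\ge\min\{\nu(f),\nu(g)\}$, $\nu(1)=0$, $\nu(0)=\infty$; non-zero polynomials may have value $\infty$). Fix an algebraic closure $\overline{\mathbb K}$ of $\mathbb K$ and a valuation $\overline\nu$ on $\overline{\mathbb K}[x]$ extending $\nu$, with values in a totally ordered abelian group containing $\Gamma$, together with $\infty$. For a non-constant polynomial $f$ put $\delta(f)=\max\{\overline\nu(x-a)\mid a\in\overline{\mathbb K},\ f(a)=0\}$, and put $\delta(f)=-\infty$ for a non-zero constant $f$. A monic polynomial $Q\in\mathbb K[x]$ is a *key polynomial* for $\nu$ if $\deg f\ge\deg Q$ for every non-zero $f\in\mathbb K[x]$ with $\delta(f)\ge\delta(Q)$. For a non-constant $q\in\mathbb K[x]$, the *truncation* of $\nu$ at $q$ is $\nu_q(f)=\min_{0\le i\le s}\nu(f_iq^i)$, where $f=f_0+f_1q+\dots+f_sq^s$ with $\deg f_i<\deg q$ for all $i$. For a valuation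 $\mu$ on $\mathbb K[x]$ let $$\mathcal G_\mu=\bigoplus_{\gamma}\{f\mid\mu(f)\ge\gamma\}/\{f\mid\mu(f)>\gamma\}$$ be its associated graded ring, where $\gamma$ runs over the finite values of $\mu$, and let $\mathrm{in}_\mu(f)\in\mathcal G_\mu$ be the class of $f$ in the component of degree $\mu(f)$, with $\mathrm{in}_\mu(f)=0$ if $\mu(f)=\infty$. When $\nu_q$ is a valuation, write $\mathcal G_q=\mathcal G_{\nu_q}$ and $\mathrm{in}_q=\mathrm{in}_{\nu_q}$, and let $R_q$ be the additive subgroup of $\mathcal G_q$ generated by $\{\mathrm{in}_q(f)\mid \deg f<\deg q\}$. Let $n\in\mathbb N$ and let $\Psi_n$ be the set of key polynomials for $\nu$ of degree $n$, preordered by $Q\preceq Q'$ if and only if $\nu_Q(f)\le\nu_{Q'}(f)$ for all $f\in\mathbb K[x]$. Assume that $\Psi_n\ne\emptyset$ and that $\{\nu(Q)\mid Q\in\Psi_n\}$ has no maximal element. Let $Q_n$ be a limit key polynomial for $\Psi_n$, i.e. a monic polynomial of least degree in the set $\{f\in\mathbb K[x]\mid\nu_Q(f)<\nu(f)\text{ for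 all }Q\in\Psi_n\}$. Then $\nu_Q$ (for every $Q\in\Psi_n$) and $\nu_{Q_n}$ are valuations on $\mathbb K[x]$; $(\Psi_n,\preceq)$ is directed; the rings $\mathcal G_Q$, $Q\in\Psi_n$, form a direct system of rings with the graded homomorphisms $\phi_{QQ'}:\mathcal G_Q\to\mathcal G_{Q'}$ ($Q\preceq Q'$) that send $\mathrm{in}_Q(f)$ to $\mathrm{in}_{Q'}(f)$ if $\nu_Q(f)=\nu_{Q'}(f)$ and to $0$ if $\nu_Q(f)<\nu_{Q'}(f)$; $R_{Q_n}$ is a subring of $\mathcal G_{Q_n}$; and $$\varinjlim_{Q\in\Psi_n}\mathcal G_Q\;\cong\;R_{Q_n}$$ as commutative rings with unity. -/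

import Mathlib

open Polynomial

noncomputable section

namespace KeyPoly

/-! ### The graded ring of a valuation -/

section Graded

variable {R Γ : Type*} [CommRing R] [AddCommGroup Γ] [LinearOrder Γ] [IsOrderedAddMonoid Γ]

/-- `𝒫_γ = {f | v f ≥ γ}`. -/
def geSubgroup (v : AddValuation R (WithTop Γ)) (γ : Γ) : AddSubgroup R where
  carrier := {f | (γ : WithTop Γ) ≤ v f}
  zero_mem' := by simp
  add_mem' := fun {a b} ha hb => le_trans (le_min ha hb) (v.map_add a b)
  neg_mem' := fun {a} ha => by simpa [AddValuation.map_neg] using ha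

/-- `𝒫_γ⁺ = {f | v f > γ}`. -/
def gtSubgroup (v : AddValuation R (WithTop Γ)) (γ : Γ) : AddSubgroup R where
  carrier := {f | (γ : WithTop Γ) < v f}
  zero_mem' := by simp
  add_mem' := fun {a b} ha hb => lt_of_lt_of_le (lt_min ha hb) (v.map_add a b)
  neg_mem' := fun {a} ha => by simpa [AddValuation.map_neg] using ha

theorem mem_geSubgroup {v : AddValuation R (WithTop Γ)} {γ : Γ} {f : R} :
    f ∈ geSubgroup v γ ↔ (γ : WithTop Γ) ≤ v f := Iff.rfl

theorem mem_gtSubgroup {v : AddValuation R (WithTop Γ)} {γ : Γ} {f : R} :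
    f ∈ gtSubgroup v γ ↔ (γ : WithTop Γ) < v f := Iff.rfl

/-- The homogeneous component `𝒫_γ / 𝒫_γ⁺`. -/
abbrev Piece (v : AddValuation R (WithTop Γ)) (γ : Γ) : Type _ :=
  geSubgroup v γ ⧸ (gtSubgroup v γ).addSubgroupOf (geSubgroup v γ)

/-- The class of `f ∈ 𝒫_γ` in `𝒫_γ / 𝒫_γ⁺`. -/
def Piece.mk (v : AddValuation R (WithTop Γ)) {γ : Γ} (f : R) (hf : (γ : WithTop Γ) ≤ v f) :
    Piece v γ :=
  QuotientAddGroup.mk (⟨f, mem_geSubgroup.2 hf⟩ : geSubgroup v γ)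

variable {v : AddValuation R (WithTop Γ)}

theorem Piece.exists_rep {γ : Γ} (z : Piece v γ) : ∃ f hf, Piece.mk v f hf = z := by
  obtain ⟨⟨f, hf⟩, rfl⟩ := QuotientAddGroup.mk_surjective z
  exact ⟨f, hf, rfl⟩

theorem Piece.mk_eq_mk {γ : Γ} {f g : R} (hf : (γ : WithTop Γ) ≤ v f)
    (hg : (γ : WithTop Γ) ≤ v g) :
    Piece.mk v f hf = Piece.mk v g hg ↔ (γ : WithTop Γ) < v (g - f) := by
  unfold Piece.mk
  rw [QuotientAddGroup.eq, AddSubgroup.mem_addSubgroupOf, sub_eq_neg_add]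
  rfl

theorem Piece.sigma_eq {γ γ' : Γ} (h : γ = γ') {f g : R} (hfg : f = g)
    (hf : (γ : WithTop Γ) ≤ v f) (hg : (γ' : WithTop Γ) ≤ v g) :
    GradedMonoid.mk (A := Piece v) γ (Piece.mk v f hf) = GradedMonoid.mk γ' (Piece.mk v g hg) := by
  subst h; subst hfg; rfl

theorem le_map_mul {γ γ' : Γ} {f g : R} (hf : (γ : WithTop Γ) ≤ v f)
    (hg : (γ' : WithTop Γ) ≤ v g) : ((γ + γ' : Γ) : WithTop Γ) ≤ v (f * g) := by
  rw [v.map_mul, WithTop.coe_add]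
  exact add_le_add hf hg

theorem le_map_add {γ : Γ} {f g : R} (hf : (γ : WithTop Γ) ≤ v f)
    (hg : (γ : WithTop Γ) ≤ v g) : (γ : WithTop Γ) ≤ v (f + g) :=
  le_trans (le_min hf hg) (v.map_add f g)

theorem zero_le_map_one : ((0 : Γ) : WithTop Γ) ≤ v 1 := by simp

theorem lt_map_mul {γ γ' : Γ} {f g : R} (hf : (γ : WithTop Γ) < v f)
    (hg : (γ' : WithTop Γ) ≤ v g) : ((γ + γ' : Γ) : WithTop Γ) < v (f * g) := by
  rw [v.map_mul, WithTop.coe_add]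
  exact lt_of_lt_of_le (WithTop.add_lt_add_right WithTop.coe_ne_top hf) (by gcongr)

/-- `(f + 𝒫_β⁺) (g + 𝒫_γ⁺) = fg + 𝒫_{β+γ}⁺`. -/
def Piece.mul {β γ : Γ} : Piece v β → Piece v γ → Piece v (β + γ) :=
  Quotient.map₂ (fun a b => ⟨a.1 * b.1, le_map_mul a.2 b.2⟩) (by
    rintro ⟨a, ha⟩ ⟨a', ha'⟩ h ⟨b, hb⟩ ⟨b', hb'⟩ h'
    have h1 := (Piece.mk_eq_mk ha ha').1 (Quotient.sound h)
    have h2 := (Piece.mk_eq_mk hb hb').1 (Quotient.sound h')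
    refine Quotient.exact ((Piece.mk_eq_mk (le_map_mul ha hb) (le_map_mul ha' hb')).2 ?_)
    have e : a' * b' - a * b = (a' - a) * b + (b' - b) * a' := by ring
    rw [e]
    refine lt_of_lt_of_le (lt_min (lt_map_mul h1 hb) ?_) (v.map_add _ _)
    rw [add_comm β γ]
    exact lt_map_mul h2 ha')

theorem Piece.mk_mul_mk {β γ : Γ} {f g : R} (hf : (β : WithTop Γ) ≤ v f)
    (hg : (γ : WithTop Γ) ≤ v g) :
    Piece.mul (Piece.mk v f hf) (Piece.mk v g hg) = Piece.mk v (f * g) (le_map_mul hf hg) := rfl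

theorem Piece.mk_add_mk {γ : Γ} {f g : R} (hf : (γ : WithTop Γ) ≤ v f)
    (hg : (γ : WithTop Γ) ≤ v g) :
    Piece.mk v f hf + Piece.mk v g hg =
      Piece.mk v (f + g) (le_map_add hf hg) := rfl

theorem Piece.mk_zero {γ : Γ} : (0 : Piece v γ) = Piece.mk v 0 (by simp) := rfl

theorem Piece.mk_congr {γ : Γ} {f g : R} (h : f = g) (hf : (γ : WithTop Γ) ≤ v f)
    (hg : (γ : WithTop Γ) ≤ v g) : Piece.mk v f hf = Piece.mk v g hg := by
  subst h; rfl

instance : GradedMonoid.GOne (Piece v) where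
  one := Piece.mk v 1 zero_le_map_one

instance : GradedMonoid.GMul (Piece v) where
  mul := Piece.mul

instance : GradedMonoid.GCommMonoid (Piece v) where
  one_mul := by
    rintro ⟨i, a⟩
    obtain ⟨f, hf, rfl⟩ := a.exists_rep
    exact Piece.sigma_eq (zero_add i) (one_mul f) (le_map_mul zero_le_map_one hf) hf
  mul_one := by
    rintro ⟨i, a⟩
    obtain ⟨f, hf, rfl⟩ := a.exists_rep
    exact Piece.sigma_eq (add_zero i) (mul_one f) (le_map_mul hf zero_le_map_one) hf
  mul_assoc := by
    rintro ⟨i, a⟩ ⟨j, b⟩ ⟨k, c⟩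
    obtain ⟨f, hf, rfl⟩ := a.exists_rep
    obtain ⟨g, hg, rfl⟩ := b.exists_rep
    obtain ⟨h, hh, rfl⟩ := c.exists_rep
    exact Piece.sigma_eq (add_assoc i j k) (mul_assoc f g h)
      (le_map_mul (le_map_mul hf hg) hh) (le_map_mul hf (le_map_mul hg hh))
  mul_comm := by
    rintro ⟨i, a⟩ ⟨j, b⟩
    obtain ⟨f, hf, rfl⟩ := a.exists_rep
    obtain ⟨g, hg, rfl⟩ := b.exists_rep
    exact Piece.sigma_eq (add_comm i j) (mul_comm f g) (le_map_mul hf hg) (le_map_mul hg hf)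

instance : DirectSum.GCommRing (Piece v) where
  __ := (inferInstance : GradedMonoid.GCommMonoid (Piece v))
  mul_zero a := by
    obtain ⟨f, hf, rfl⟩ := a.exists_rep
    exact Piece.mk_congr (mul_zero f) (le_map_mul hf (by simp)) (by simp)
  zero_mul a := by
    obtain ⟨f, hf, rfl⟩ := a.exists_rep
    exact Piece.mk_congr (zero_mul f) (le_map_mul (by simp) hf) (by simp)
  mul_add a b c := by
    obtain ⟨f, hf, rfl⟩ := a.exists_rep
    obtain ⟨g, hg, rfl⟩ := b.exists_rep
    obtain ⟨h, hh, rfl⟩ := c.exists_rep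
    exact Piece.mk_congr (mul_add f g h) (le_map_mul hf (le_map_add hg hh))
      (le_map_add (le_map_mul hf hg) (le_map_mul hf hh))
  add_mul a b c := by
    obtain ⟨f, hf, rfl⟩ := a.exists_rep
    obtain ⟨g, hg, rfl⟩ := b.exists_rep
    obtain ⟨h, hh, rfl⟩ := c.exists_rep
    exact Piece.mk_congr (add_mul f g h) (le_map_mul (le_map_add hf hg) hh)
      (le_map_add (le_map_mul hf hh) (le_map_mul hg hh))
  natCast n := n • Piece.mk v 1 zero_le_map_one
  natCast_zero := zero_nsmul _
  natCast_succ n := succ_nsmul _ n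
  intCast n := n • Piece.mk v 1 zero_le_map_one
  intCast_ofNat n := natCast_zsmul _ n
  intCast_negSucc_ofNat n := negSucc_zsmul _ n

variable (v) in
/-- The graded ring `𝒢_v = ⨁_γ 𝒫_γ / 𝒫_γ⁺`. The sum is taken over all `γ : Γ`; the components at
those `γ` that are not values of `v` are zero (see `Piece.subsingleton`). -/
abbrev GrRing : Type _ := DirectSum Γ (Piece v)

theorem Piece.subsingleton {γ : Γ} (h : ∀ f, v f ≠ γ) : Subsingleton (Piece v γ) := by
  refine ⟨fun a b => ?_⟩
  obtain ⟨f, hf, rfl⟩ := a.exists_rep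
  obtain ⟨g, hg, rfl⟩ := b.exists_rep
  rw [Piece.mk_eq_mk]
  exact lt_of_le_of_ne ((geSubgroup v γ).sub_mem hg hf) (h _).symm

variable (v) in
/-- The initial form `in_v(f) ∈ 𝒢_v`: the class of `f` in the component of degree `v f`, and `0` if
`v f = ∞`. -/
def inForm (f : R) : GrRing v :=
  open Classical in
  if h : v f = ⊤ then 0
  else DirectSum.of (Piece v) ((v f).untop h) (Piece.mk v f (by simp))

variable {w : AddValuation R (WithTop Γ)}

/-- For `v ≤ w`, the map `𝒫_γ(v) / 𝒫_γ⁺(v) → 𝒫_γ(w) / 𝒫_γ⁺(w)`, `f + 𝒫_γ⁺(v) ↦ f + 𝒫_γ⁺(w)`. -/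
def pieceMap (h : ∀ f, v f ≤ w f) (γ : Γ) : Piece v γ →+ Piece w γ :=
  QuotientAddGroup.map _ _
    (AddSubgroup.inclusion (fun f (hf : (γ : WithTop Γ) ≤ v f) => hf.trans (h f)))
    (fun f hf => lt_of_lt_of_le (AddSubgroup.mem_addSubgroupOf.1 hf) (h f.1))

theorem pieceMap_mk (h : ∀ f, v f ≤ w f) {γ : Γ} {f : R} (hf : (γ : WithTop Γ) ≤ v f) :
    pieceMap h γ (Piece.mk v f hf) = Piece.mk w f (hf.trans (h f)) := rfl

/-- For `v ≤ w`, the graded ring homomorphism `φ : 𝒢_v → 𝒢_w`; on initial forms it is described by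
`grMap_inForm`. -/
def grMap (h : ∀ f, v f ≤ w f) : GrRing v →+* GrRing w :=
  DirectSum.toSemiring (fun γ => (DirectSum.of (Piece w) γ).comp (pieceMap h γ))
    (by rw [DirectSum.one_def]; rfl) (by
    intro i j a b
    obtain ⟨f, hf, rfl⟩ := a.exists_rep
    obtain ⟨g, hg, rfl⟩ := b.exists_rep
    simp only [AddMonoidHom.comp_apply, DirectSum.of_mul_of]
    rfl)

open Classical in
/-- `φ(in_v(f))` is `in_w(f)` if `v f = w f`, and `0` if `v f < w f`. -/
theorem grMap_inForm (h : ∀ f, v f ≤ w f) (f : R) :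
    grMap h (inForm v f) = if v f = w f then inForm w f else 0 := by
  by_cases hv : v f = ⊤
  · have hw : w f = ⊤ := top_le_iff.1 (hv ▸ h f)
    simp [inForm, hv, hw]
  · have e : grMap h (inForm v f) =
        DirectSum.of (Piece w) ((v f).untop hv) (Piece.mk w f (by simpa using h f)) := by
      rw [inForm, dif_neg hv, grMap, DirectSum.toSemiring_of]
      rfl
    rw [e]
    split_ifs with hvw
    · have hw : w f ≠ ⊤ := hvw ▸ hv
      rw [inForm, dif_neg hw]
      exact DirectSum.of_eq_of_gradedMonoid_eq
        (Piece.sigma_eq (by simp only [hvw]) rfl _ _)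
    · have : Piece.mk w f (γ := (v f).untop hv) (by simpa using h f) = 0 := by
        rw [Piece.mk_zero, eq_comm, Piece.mk_eq_mk]
        simpa using lt_of_le_of_ne (h f) hvw
      rw [this, _root_.map_zero]

end Graded

/-! ### Truncations -/

section Truncation

variable {K Γ : Type*} [Field K] [AddCommGroup Γ] [LinearOrder Γ] [IsOrderedAddMonoid Γ]

/-- The `i`-th coefficient `f_i` of the `q`-expansion `f = f_0 + f_1 q + ⋯ + f_s q ^ s`,
`deg f_i < deg q`, of `f`, for a non-constant polynomial `q`
(see `degree_qCoeff_lt` and `sum_qCoeff`). -/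
def qCoeff (q : K[X]) : K[X] → ℕ → K[X]
  | f, 0 => f % q
  | f, i + 1 => qCoeff q (f / q) i

theorem degree_qCoeff_lt {q : K[X]} (hq : 0 < q.degree) (f : K[X]) (i : ℕ) :
    (qCoeff q f i).degree < q.degree := by
  induction i generalizing f with
  | zero => exact EuclideanDomain.mod_lt _ (ne_zero_of_degree_gt hq)
  | succ i ih => exact ih _

theorem sum_qCoeff {q : K[X]} (hq : 0 < q.degree) (N : ℕ) (f : K[X]) (hN : f.degree < N) :
    ∑ i ∈ Finset.range N, qCoeff q f i * q ^ i = f := by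
  induction N generalizing f with
  | zero => simpa using (degree_eq_bot.1 (Nat.WithBot.lt_zero_iff.1 hN)).symm
  | succ N ih =>
    have hd : (f / q).degree < N := by
      rcases eq_or_ne f 0 with rfl | hf
      · simp
      · have h1 := degree_div_lt hf hq
        rw [degree_eq_natDegree hf] at h1 hN
        exact lt_of_lt_of_le h1 (by exact_mod_cast Nat.lt_succ_iff.1 (by exact_mod_cast hN))
    have h2 := ih (f / q) hd
    rw [Finset.sum_range_succ']
    simp only [qCoeff, pow_succ, pow_zero, mul_one, ← mul_assoc]
    rw [← Finset.sum_mul, h2, mul_comm]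
    exact EuclideanDomain.div_add_mod f q

/-- The truncation `ν_q(f) = min_i ν(f_i q ^ i)` of `ν` at a non-constant polynomial `q`. The
`q`-expansion of `f` has no non-zero coefficients beyond the index `deg f`, and zero coefficients do
not contribute to the minimum. -/
def truncation (ν : AddValuation K[X] (WithTop Γ)) (q f : K[X]) : WithTop Γ :=
  (Finset.range (f.natDegree + 1)).inf fun i => ν (qCoeff q f i * q ^ i)

/-- The truncation of `ν` at `q` as a valuation. This type has one element if the
map `truncation ν q` is a valuation and is empty if not. -/
structure TruncVal (ν : AddValuation K[X] (WithTop Γ)) (q : K[X]) where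
  /-- the valuation `ν_q` -/
  val : AddValuation K[X] (WithTop Γ)
  val_eq : ∀ f, val f = truncation ν q f

/-- The graded ring `𝒢_q` of the valuation `ν_q`. -/
abbrev TruncVal.Gr {ν : AddValuation K[X] (WithTop Γ)} {q : K[X]} (w : TruncVal ν q) : Type _ :=
  GrRing w.val

/-- `R_q`: the additive subgroup of `𝒢_q` generated by the initial forms `in_q(f)`,
`deg f < deg q`. -/
def TruncVal.R {ν : AddValuation K[X] (WithTop Γ)} {q : K[X]} (w : TruncVal ν q) :
    AddSubgroup w.Gr :=
  AddSubgroup.closure {z | ∃ f : K[X], f.degree < q.degree ∧ inForm w.val f = z}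

/-- The map `φ_{QQ'} : 𝒢_Q → 𝒢_Q'` for `ν_Q ≤ ν_Q'`. -/
def TruncVal.phi {ν : AddValuation K[X] (WithTop Γ)} {Q Q' : K[X]} (w : TruncVal ν Q)
    (w' : TruncVal ν Q') (h : ∀ f, truncation ν Q f ≤ truncation ν Q' f) : w.Gr →+* w'.Gr :=
  grMap fun f => by rw [w.val_eq, w'.val_eq]; exact h f

end Truncation

/-! ### Key polynomials and limit key polynomials -/

section Key

variable {K L Γ Γ' : Type*} [Field K] [Field L] [Algebra K L]
  [AddCommGroup Γ] [LinearOrder Γ] [IsOrderedAddMonoid Γ]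
  [AddCommGroup Γ'] [LinearOrder Γ'] [IsOrderedAddMonoid Γ']

/-- `δ(f) = max {ν̄(x - a) | f(a) = 0}` for a non-constant polynomial `f` over an algebraically
closed field, and `δ(f) = -∞` for a non-zero constant `f`. -/
def delta (νbar : AddValuation L[X] (WithTop Γ')) (f : L[X]) : WithBot (WithTop Γ') :=
  open Classical in f.roots.toFinset.sup fun a => ((νbar (X - C a) : WithTop Γ') : WithBot _)

/-- `Q` is a key polynomial (for the restriction to `K[x]` of the valuation `ν̄` of `L[x]`, `L` an
algebraic closure of `K`). -/
def IsKeyPoly (νbar : AddValuation L[X] (WithTop Γ')) (Q : K[X]) : Prop :=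
  Q.Monic ∧ ∀ f : K[X], f ≠ 0 →
    delta νbar (Q.map (algebraMap K L)) ≤ delta νbar (f.map (algebraMap K L)) →
      Q.degree ≤ f.degree

/-- `Ψ_n`: the key polynomials of degree `n`. The valuation `ν` enters through the preorder. -/
structure Psi (ν : AddValuation K[X] (WithTop Γ)) (νbar : AddValuation L[X] (WithTop Γ'))
    (n : ℕ) where
  /-- the key polynomial -/
  poly : K[X]
  isKeyPoly : IsKeyPoly νbar poly
  natDegree_eq : poly.natDegree = n

/-- `Q ⪯ Q'` if and only if `ν_Q ≤ ν_Q'`. -/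
instance (ν : AddValuation K[X] (WithTop Γ)) (νbar : AddValuation L[X] (WithTop Γ')) (n : ℕ) :
    Preorder (Psi ν νbar n) where
  le Q Q' := ∀ f, truncation ν Q.poly f ≤ truncation ν Q'.poly f
  le_refl _ _ := le_rfl
  le_trans _ _ _ h h' f := (h f).trans (h' f)

/-- `𝒦_n = {f | ν_Q(f) < ν(f) for all Q ∈ Ψ_n}`. -/
def limitSet (ν : AddValuation K[X] (WithTop Γ)) (νbar : AddValuation L[X] (WithTop Γ')) (n : ℕ) :
    Set K[X] :=
  {f | ∀ Q : Psi ν νbar n, truncation ν Q.poly f < ν f}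

/-- `Qn` is a limit key polynomial for `Ψ_n`: a monic polynomial of least degree in `𝒦_n`. -/
def IsLimitKeyPoly (ν : AddValuation K[X] (WithTop Γ)) (νbar : AddValuation L[X] (WithTop Γ'))
    (n : ℕ) (Qn : K[X]) : Prop :=
  Qn.Monic ∧ Qn ∈ limitSet ν νbar n ∧ ∀ f ∈ limitSet ν νbar n, Qn.degree ≤ f.degree

end Key

end KeyPoly

end

open KeyPoly

/-!
Reduction modulo a key polynomial `Q` preserves the value of a product of two polynomials of lower
degree: if `a` is a root of `Q` with `ν̄(x - a)` maximal, every root `b` of a polynomial `f` with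
`deg f < deg Q` satisfies `ν̄(x - b) < ν̄(x - a)`, whence `ν̄(f(a)) = ν(f)`, and evaluation at `a`
does not see the reduction. This invariance makes the truncation `ν_Q` a valuation.

If `ν(Q) < ν(Q')` then `ν_Q ≤ ν_Q'`, with strict inequality at every `f` such that `ν_Q(f) < ν(f)`.
Hence the values `ν_Q(Q_n)` have no maximum, while for `deg f < deg Q_n` the value `ν_Q(f)` is
eventually `ν(f)`. For `f = Q_n g + r` with `deg r < deg Q_n`, the value `ν_Q(Q_n g)` keeps
increasing after `ν_Q(r)` has stabilised. It follows that products can be reduced modulo `Q_n` as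
above, so that `ν_{Q_n}` is a valuation, that `ν_Q ≤ ν_{Q_n}`, that `ν_Q(f)` keeps increasing as
long as it is less than `ν_{Q_n}(f)`, and that it reaches `ν_{Q_n}(f)` only if `f` and `r` have the
same initial form for `ν_{Q_n}`. The last two facts say that `lim 𝒢_Q → 𝒢_{Q_n}` is injective and
that its image is `R_{Q_n}`.
-/

noncomputable section

namespace KeyPoly

open Filter

section Truncation

variable {K Γ : Type*} [Field K] [AddCommGroup Γ] [LinearOrder Γ] [IsOrderedAddMonoid Γ]
  {ν : AddValuation K[X] (WithTop Γ)} {p q : K[X]}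

theorem mul_div_eq_sub_mod (f q : K[X]) : q * (f / q) = f - f % q :=
  eq_sub_of_add_eq (EuclideanDomain.div_add_mod f q)

theorem add_div_eq (hq : q ≠ 0) (f g : K[X]) : (f + g) / q = f / q + g / q := by
  apply mul_left_cancel₀ hq
  rw [mul_add, mul_div_eq_sub_mod, mul_div_eq_sub_mod, mul_div_eq_sub_mod, add_mod]
  ring

theorem degree_mul_div_lt {f g : K[X]} (hf : f.degree < q.degree) (hg : g.degree < q.degree) :
    (f * g / q).degree < q.degree := by
  have hq : q ≠ 0 := ne_zero_of_degree_gt hf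
  by_cases hz : f * g / q = 0
  · rw [hz, degree_zero]
    exact bot_lt_iff_ne_bot.2 (degree_ne_bot.2 hq)
  · have hle : q.degree ≤ (f * g).degree := not_lt.1 (mt (Polynomial.div_eq_zero_iff hq).2 hz)
    have hg0 : g ≠ 0 := by
      rintro rfl
      simp at hz
    have hadd : q.degree + (f * g / q).degree < q.degree + q.degree := by
      rw [degree_add_div hq hle, degree_mul]
      exact (WithBot.add_lt_add_right (degree_ne_bot.2 hg0) hf).trans
        (WithBot.add_lt_add_left (degree_ne_bot.2 hq) hg)
    exact lt_of_add_lt_add_left hadd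

theorem degree_div_lt_natCast (hq : 0 < q.degree) {f : K[X]} {i : ℕ}
    (hf : f.degree < (i + 1 : ℕ)) : (f / q).degree < i := by
  rcases eq_or_ne f 0 with rfl | hf0
  · simp
  · have hlt := degree_div_lt hf0 hq
    rw [degree_eq_natDegree hf0] at hlt hf
    exact hlt.trans_le (by exact_mod_cast Nat.lt_succ_iff.1 (by exact_mod_cast hf))

theorem div_induction (hq : 0 < q.degree) {motive : K[X] → Prop}
    (of_degree_lt : ∀ f, f.degree < q.degree → motive f)
    (of_div : ∀ f, motive (f / q) → motive f) (f : K[X]) : motive f := by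
  induction hn : f.natDegree using Nat.strong_induction_on generalizing f with
  | _ n ih =>
    by_cases hf : f.degree < q.degree
    · exact of_degree_lt f hf
    · have hpos : 0 < f.degree := hq.trans_le (not_lt.1 hf)
      refine of_div f (ih _ ?_ _ rfl)
      rw [← hn]
      exact natDegree_lt_natDegree
        (mt (Polynomial.div_eq_zero_iff (ne_zero_of_degree_gt hq)).1 hf)
        (degree_div_lt (ne_zero_of_degree_gt hpos) hq)

theorem qCoeff_add (hq : q ≠ 0) (f g : K[X]) (i : ℕ) :
    qCoeff q (f + g) i = qCoeff q f i + qCoeff q g i := by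
  induction i generalizing f g with
  | zero => exact add_mod f g q
  | succ i ih => simp only [qCoeff, add_div_eq hq, ih]

theorem qCoeff_eq_zero_of_degree_lt (hq : 0 < q.degree) {f : K[X]} {i : ℕ} (hf : f.degree < i) :
    qCoeff q f i = 0 := by
  induction i generalizing f with
  | zero =>
    obtain rfl : f = 0 := degree_eq_bot.1 (Nat.WithBot.lt_zero_iff.1 hf)
    exact EuclideanDomain.zero_mod q
  | succ i ih => exact ih (degree_div_lt_natCast hq hf)

theorem truncation_eq_inf (hq : 0 < q.degree) {f : K[X]} {N : ℕ} (hN : f.natDegree < N) :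
    truncation ν q f = (Finset.range N).inf fun i => ν (qCoeff q f i * q ^ i) := by
  apply le_antisymm
  · refine Finset.le_inf fun i _ => ?_
    by_cases hi : i < f.natDegree + 1
    · exact Finset.inf_le (Finset.mem_range.2 hi)
    · have hdeg : f.degree < i :=
        degree_le_natDegree.trans_lt (by exact_mod_cast not_lt.1 hi)
      rw [qCoeff_eq_zero_of_degree_lt hq hdeg, zero_mul, ν.map_zero]
      exact le_top
  · exact Finset.inf_mono (Finset.range_mono hN)

theorem truncation_zero : truncation ν q 0 = ⊤ := by
  simp [truncation, qCoeff]

theorem truncation_eq_min (hq : 0 < q.degree) (f : K[X]) :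
    truncation ν q f = min (ν (f % q)) (truncation ν q (f / q) + ν q) := by
  have hdeg : (f / q).natDegree < f.natDegree + 1 :=
    Nat.lt_succ_of_le (natDegree_le_natDegree (degree_div_le f q))
  rw [truncation_eq_inf hq (N := f.natDegree + 1 + 1) (by omega), truncation_eq_inf hq hdeg,
    Finset.range_add_one', Finset.inf_insert, Finset.inf_map]
  congr 1
  · rw [pow_zero, mul_one, qCoeff]
  · rw [Finset.apply_inf_eq_inf_comp_of_linearOrder (fun x : WithTop Γ => x + ν q)
      (fun a b h => by simpa using add_le_add_left h (ν q)) (top_add _)]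
    refine Finset.inf_congr rfl fun i _ => ?_
    change ν (qCoeff q (f / q) i * q ^ (i + 1)) = ν (qCoeff q (f / q) i * q ^ i) + ν q
    rw [pow_succ, ← mul_assoc, ν.map_mul (_ * _) q]

theorem truncation_le_map_mod (hq : 0 < q.degree) (f : K[X]) : truncation ν q f ≤ ν (f % q) :=
  (truncation_eq_min hq f).trans_le (min_le_left _ _)

theorem truncation_of_degree_lt (hq : 0 < q.degree) {f : K[X]} (hf : f.degree < q.degree) :
    truncation ν q f = ν f := by
  have hq0 := ne_zero_of_degree_gt hq
  rw [truncation_eq_min hq, (mod_eq_self_iff hq0).2 hf, (Polynomial.div_eq_zero_iff hq0).2 hf,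
    truncation_zero, top_add, min_eq_left le_top]

theorem truncation_mul_self (hq : 0 < q.degree) (f : K[X]) :
    truncation ν q (q * f) = truncation ν q f + ν q := by
  rw [truncation_eq_min hq, mul_div_cancel_left₀ _ (ne_zero_of_degree_gt hq),
    EuclideanDomain.mod_eq_zero.2 (dvd_mul_right q f), ν.map_zero, min_eq_right le_top]

theorem truncation_self (hq : 0 < q.degree) : truncation ν q q = ν q := by
  have hone : truncation ν q 1 = 0 := by
    rw [truncation_of_degree_lt hq (degree_one.trans_lt hq), ν.map_one]
  simpa only [mul_one, hone, zero_add] using truncation_mul_self (ν := ν) hq 1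

theorem truncation_eq_min_mul_div (hq : 0 < q.degree) (f : K[X]) :
    truncation ν q f = min (ν (f % q)) (truncation ν q (q * (f / q))) := by
  rw [truncation_mul_self hq, truncation_eq_min hq f]

theorem truncation_pow_mul (hq : 0 < q.degree) (k : ℕ) (f : K[X]) :
    truncation ν q (q ^ k * f) = truncation ν q f + k • ν q := by
  induction k with
  | zero => rw [pow_zero, one_mul, zero_nsmul, add_zero]
  | succ k ih => rw [pow_succ', mul_assoc, truncation_mul_self hq, ih, succ_nsmul, add_assoc]

theorem truncation_le_of_le (hq : 0 < q.degree) {v : AddValuation K[X] (WithTop Γ)}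
    (hlow : ∀ f : K[X], f.degree < q.degree → ν f ≤ v f) (hle : ν q ≤ v q) (f : K[X]) :
    truncation ν q f ≤ v f := by
  have hsum := sum_qCoeff hq (f.natDegree + 1) f
    (degree_le_natDegree.trans_lt (by exact_mod_cast Nat.lt_succ_self _))
  conv_rhs => rw [← hsum]
  refine v.map_le_sum fun i hi => (Finset.inf_le hi).trans ?_
  rw [ν.map_mul, v.map_mul, ν.map_pow, v.map_pow]
  exact add_le_add (hlow _ (degree_qCoeff_lt hq f i)) (nsmul_le_nsmul_right hle i)

theorem truncation_le (hq : 0 < q.degree) (f : K[X]) : truncation ν q f ≤ ν f :=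
  truncation_le_of_le hq (fun _ _ => le_rfl) le_rfl f

theorem min_le_truncation_add (hq : 0 < q.degree) (f g : K[X]) :
    min (truncation ν q f) (truncation ν q g) ≤ truncation ν q (f + g) := by
  obtain ⟨N, hf, hg, hfg⟩ : ∃ N, f.natDegree < N ∧ g.natDegree < N ∧ (f + g).natDegree < N :=
    ⟨f.natDegree + g.natDegree + (f + g).natDegree + 1, by omega, by omega, by omega⟩
  rw [truncation_eq_inf hq hf, truncation_eq_inf hq hg, truncation_eq_inf hq hfg]
  refine Finset.le_inf fun i hi => ?_
  rw [qCoeff_add (ne_zero_of_degree_gt hq), add_mul]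
  exact (min_le_min (Finset.inf_le hi) (Finset.inf_le hi)).trans (ν.map_add _ _)

theorem le_truncation_sum (hq : 0 < q.degree) {ι : Type*} {s : Finset ι} {f : ι → K[X]}
    {γ : WithTop Γ} (hf : ∀ i ∈ s, γ ≤ truncation ν q (f i)) :
    γ ≤ truncation ν q (∑ i ∈ s, f i) :=
  Finset.sum_induction f (fun g => γ ≤ truncation ν q g)
    (fun a b ha hb => (le_min ha hb).trans (min_le_truncation_add hq a b))
    (truncation_zero.ge.trans' le_top) hf

variable (ν q) in
/-- Reduction modulo the non-constant polynomial `q` does not change the value of a product of two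
polynomials of degree less than `deg q`. For such `q` the truncation `ν_q` is a valuation. -/
structure IsMulModInvariant : Prop where
  degree_pos : 0 < q.degree
  map_mul_mod : ∀ f g : K[X], f.degree < q.degree → g.degree < q.degree →
    ν (f * g % q) = ν (f * g)

namespace IsMulModInvariant

theorem add_le_truncation_mul_of_degree_lt (H : IsMulModInvariant ν q) {f g : K[X]}
    (hf : f.degree < q.degree) (hg : g.degree < q.degree) :
    ν f + ν g ≤ truncation ν q (f * g) := by
  have hmod := H.map_mul_mod f g hf hg
  have hdiv : ν (f * g) ≤ ν (q * (f * g / q)) := by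
    rw [mul_div_eq_sub_mod]
    exact ν.map_le_sub le_rfl hmod.ge
  rw [truncation_eq_min H.degree_pos,
    truncation_of_degree_lt H.degree_pos (degree_mul_div_lt hf hg),
    hmod, ← ν.map_mul, ← ν.map_mul, mul_comm _ q]
  exact le_min le_rfl hdiv

theorem add_le_truncation_mul (H : IsMulModInvariant ν q) (f g : K[X]) :
    truncation ν q f + truncation ν q g ≤ truncation ν q (f * g) := by
  have hq := H.degree_pos
  have hsum (f : K[X]) := sum_qCoeff hq (f.natDegree + 1) f
    (degree_le_natDegree.trans_lt (by exact_mod_cast Nat.lt_succ_self _))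
  have hterm (f : K[X]) {i : ℕ} (hi : i ∈ Finset.range (f.natDegree + 1)) :
      truncation ν q f ≤ ν (qCoeff q f i) + i • ν q := by
    rw [← ν.map_pow, ← ν.map_mul]
    exact Finset.inf_le hi
  conv_rhs => rw [← hsum f, ← hsum g, Finset.sum_mul_sum]
  refine le_truncation_sum hq fun i hi => le_truncation_sum hq fun j hj => ?_
  have hexp : qCoeff q f i * q ^ i * (qCoeff q g j * q ^ j) =
      q ^ (i + j) * (qCoeff q f i * qCoeff q g j) := by ring
  rw [hexp, truncation_pow_mul hq]
  calc truncation ν q f + truncation ν q g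
      ≤ (ν (qCoeff q f i) + i • ν q) + (ν (qCoeff q g j) + j • ν q) :=
        add_le_add (hterm f hi) (hterm g hj)
    _ = ν (qCoeff q f i) + ν (qCoeff q g j) + (i + j) • ν q := by
        rw [add_nsmul, add_add_add_comm]
    _ ≤ truncation ν q (qCoeff q f i * qCoeff q g j) + (i + j) • ν q := by
        gcongr
        exact H.add_le_truncation_mul_of_degree_lt (degree_qCoeff_lt hq f i)
          (degree_qCoeff_lt hq g j)

theorem truncation_mul_of_eq_map_mod (H : IsMulModInvariant ν q) {f g : K[X]}
    (hf : truncation ν q f = ν (f % q)) (hg : truncation ν q g = ν (g % q)) :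
    truncation ν q (f * g) = truncation ν q f + truncation ν q g := by
  have hq := H.degree_pos
  have hmod (f : K[X]) : (f % q).degree < q.degree := degree_mod_lt f (ne_zero_of_degree_gt hq)
  refine le_antisymm ((truncation_le_map_mod hq _).trans_eq ?_) (H.add_le_truncation_mul f g)
  rw [mul_mod, H.map_mul_mod _ _ (hmod f) (hmod g), ν.map_mul, hf, hg]

theorem truncation_mul_of_lt_map_mod (H : IsMulModInvariant ν q) {f g : K[X]}
    (hf : truncation ν q f < ν (f % q))
    (hdiv : truncation ν q (f / q * g) = truncation ν q (f / q) + truncation ν q g) :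
    truncation ν q (f * g) = truncation ν q f + truncation ν q g := by
  have hq := H.degree_pos
  have hf' : truncation ν q f = truncation ν q (f / q) + ν q := by
    rw [truncation_eq_min hq f] at hf ⊢
    exact min_eq_right (le_of_not_ge fun h => hf.ne (min_eq_left h))
  have hmul : truncation ν q (q * (f / q * g)) = truncation ν q f + truncation ν q g := by
    rw [truncation_mul_self hq, hdiv, hf', add_right_comm]
  refine le_antisymm (not_lt.1 fun hlt => ?_) (H.add_le_truncation_mul f g)
  have hg : truncation ν q g ≠ ⊤ := fun h => by simp [h] at hlt
  have hmod : truncation ν q f + truncation ν q g < truncation ν q (-(f % q) * g) :=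
    calc truncation ν q f + truncation ν q g
        < ν (f % q) + truncation ν q g := WithTop.add_lt_add_right hg hf
      _ = truncation ν q (-(f % q)) + truncation ν q g := by
          have hdeg := (degree_neg _).trans_lt (degree_mod_lt f (ne_zero_of_degree_gt hq))
          rw [truncation_of_degree_lt hq hdeg, ν.map_neg]
      _ ≤ truncation ν q (-(f % q) * g) := H.add_le_truncation_mul _ _
  -- Both summands of `q * (f / q) * g = f * g - (f % q) * g` would have values greater than
  -- `truncation ν q f + truncation ν q g`.
  have hsum : q * (f / q * g) = f * g + -(f % q) * g := by
    rw [← mul_assoc, mul_div_eq_sub_mod]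
    ring
  have := (lt_min hlt hmod).trans_le (min_le_truncation_add hq (f * g) (-(f % q) * g))
  exact (this.trans_eq (hsum ▸ hmul)).false

theorem truncation_mul (H : IsMulModInvariant ν q) (f g : K[X]) :
    truncation ν q (f * g) = truncation ν q f + truncation ν q g := by
  have hq := H.degree_pos
  have eq_map_mod_of_degree_lt {f : K[X]} (hf : f.degree < q.degree) :
      truncation ν q f = ν (f % q) := by
    rw [(mod_eq_self_iff (ne_zero_of_degree_gt hq)).2 hf, truncation_of_degree_lt hq hf]
  have mul_of_eq_map_mod {f : K[X]} (hf : truncation ν q f = ν (f % q)) (g : K[X]) :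
      truncation ν q (f * g) = truncation ν q f + truncation ν q g := by
    induction g using div_induction hq with
    | of_degree_lt g hg => exact H.truncation_mul_of_eq_map_mod hf (eq_map_mod_of_degree_lt hg)
    | of_div g ih =>
      rcases (truncation_le_map_mod (ν := ν) hq g).eq_or_lt with hg | hg
      · exact H.truncation_mul_of_eq_map_mod hf hg
      · rw [mul_comm, add_comm]
        exact H.truncation_mul_of_lt_map_mod hg (by rw [mul_comm, ih, add_comm])
  induction f using div_induction hq with
  | of_degree_lt f hf => exact mul_of_eq_map_mod (eq_map_mod_of_degree_lt hf) g
  | of_div f ih =>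
    rcases (truncation_le_map_mod (ν := ν) hq f).eq_or_lt with hf | hf
    · exact mul_of_eq_map_mod hf g
    · exact H.truncation_mul_of_lt_map_mod hf ih

/-- The truncation `ν_q` as a valuation. -/
def truncVal (H : IsMulModInvariant ν q) : TruncVal ν q where
  val := AddValuation.of (truncation ν q) truncation_zero
    (by rw [truncation_of_degree_lt H.degree_pos (degree_one.trans_lt H.degree_pos), ν.map_one])
    (min_le_truncation_add H.degree_pos) H.truncation_mul
  val_eq _ := rfl

end IsMulModInvariant

theorem map_lt_truncation (hq : 0 < q.degree) {v : AddValuation K[X] (WithTop Γ)}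
    (hle : ∀ f, v f ≤ truncation ν q f) (hlow : ∀ f : K[X], f.degree < q.degree → ν f ≤ v f)
    (hlt : v q < ν q) {f : K[X]} (hf : v f < ν f) : v f < truncation ν q f := by
  have hmod : v f ≤ ν (f % q) := (hle f).trans (truncation_le_map_mod hq f)
  have hmul : v f ≤ v (q * (f / q)) := by
    rw [mul_div_eq_sub_mod]
    exact v.map_le_sub le_rfl
      (hmod.trans (hlow _ (degree_mod_lt f (ne_zero_of_degree_gt hq))))
  have hmul_lt : v f < truncation ν q (q * (f / q)) := by
    by_cases hdiv : v (f / q) = ⊤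
    · have htop : truncation ν q (f / q) = ⊤ := top_le_iff.1 (hdiv ▸ hle (f / q))
      rw [truncation_mul_self hq, htop, top_add]
      exact hf.trans_le le_top
    · calc v f ≤ v (f / q) + v q := by rwa [add_comm, ← v.map_mul]
        _ < truncation ν q (f / q) + ν q := WithTop.add_lt_add_of_le_of_lt hdiv (hle _) hlt
        _ = truncation ν q (q * (f / q)) := (truncation_mul_self hq _).symm
  have hmod_lt : v f < ν (f % q) := by
    rw [EuclideanDomain.mod_eq_sub_mul_div, sub_eq_add_neg]
    exact ν.map_lt_add hf (by rw [ν.map_neg]; exact hmul_lt.trans_le (truncation_le hq _))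
  rw [truncation_eq_min_mul_div hq]
  exact lt_min hmod_lt hmul_lt

theorem degree_sub_lt_of_monic (hp : p.Monic) (hq : q.Monic) (hdeg : p.degree = q.degree) :
    (p - q).degree < q.degree :=
  hdeg ▸ degree_sub_lt_left hdeg hp.ne_zero (by rw [hp.leadingCoeff, hq.leadingCoeff])

theorem mod_eq_sub_of_monic (hp : p.Monic) (hq : q.Monic) (hdeg : p.degree = q.degree) :
    p % q = p - q := by
  rw [← (mod_eq_self_iff hq.ne_zero).2 (degree_sub_lt_of_monic hp hq hdeg), sub_mod,
    EuclideanDomain.mod_self, sub_zero]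

theorem degree_pos_of_map_lt (hp : p.Monic) (hq : q.Monic)
    (hdeg : p.degree = q.degree) (hlt : ν p < ν q) : 0 < p.degree := by
  by_contra! hle
  rw [hp.degree_le_zero_iff_eq_one.1 hle, hq.degree_le_zero_iff_eq_one.1 (hdeg ▸ hle)] at hlt
  exact hlt.false

theorem TruncVal.val_of_degree_lt (w : TruncVal ν q) (hq : 0 < q.degree) {f : K[X]}
    (hf : f.degree < q.degree) : w.val f = ν f := by
  rw [w.val_eq, truncation_of_degree_lt hq hf]

theorem truncation_le_truncation (w : TruncVal ν q) (hq : 0 < q.degree) (hp : p.Monic)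
    (hqm : q.Monic) (hdeg : p.degree = q.degree) (hle : ν p ≤ ν q) (f : K[X]) :
    truncation ν p f ≤ truncation ν q f := by
  rw [← w.val_eq]
  refine truncation_le_of_le (hdeg ▸ hq) (fun g hg => ?_) ?_ f
  · rw [w.val_of_degree_lt hq (hdeg ▸ hg)]
  · have hsub : ν p ≤ w.val (p - q) := by
      rw [w.val_of_degree_lt hq (degree_sub_lt_of_monic hp hqm hdeg)]
      exact ν.map_le_sub le_rfl hle
    have hself : ν p ≤ w.val q := by rwa [w.val_eq, truncation_self hq]
    simpa only [sub_add_cancel] using w.val.map_le_add hsub hself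

theorem truncation_lt_truncation (v : TruncVal ν p) (w : TruncVal ν q) (hq : 0 < q.degree)
    (hp : p.Monic) (hqm : q.Monic) (hdeg : p.degree = q.degree) (hlt : ν p < ν q) {f : K[X]}
    (hf : truncation ν p f < ν f) : truncation ν p f < truncation ν q f := by
  have hp0 : 0 < p.degree := hdeg ▸ hq
  rw [← v.val_eq] at hf ⊢
  refine map_lt_truncation hq (fun g => ?_) (fun g hg => ?_) ?_ hf
  · rw [v.val_eq]
    exact truncation_le_truncation w hq hp hqm hdeg hlt.le g
  · rw [v.val_of_degree_lt hp0 (hdeg ▸ hg)]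
  · calc v.val q = truncation ν p q := v.val_eq q
      _ ≤ ν (q % p) := truncation_le_map_mod hp0 q
      _ = ν p := by rw [mod_eq_sub_of_monic hqm hp hdeg.symm, ν.map_sub_eq_of_lt_right hlt]
      _ < ν q := hlt

end Truncation

section KeyPolynomial

variable {K L Γ Γ' : Type*} [Field K] [Field L]
  [AddCommGroup Γ] [LinearOrder Γ] [IsOrderedAddMonoid Γ]
  [AddCommGroup Γ'] [LinearOrder Γ'] [IsOrderedAddMonoid Γ']
  {νbar : AddValuation L[X] (WithTop Γ')}

theorem map_C_eval_eq {f : L[X]} (hf : f.Splits) {a : L}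
    (ha : ∀ b ∈ f.roots, νbar (X - C b) < νbar (X - C a)) : νbar (C (f.eval a)) = νbar f := by
  conv_rhs => rw [hf.eq_prod_roots]
  conv_lhs => rw [hf.eq_prod_roots]
  generalize f.roots = s at ha
  rw [eval_mul, eval_C, C_mul, νbar.map_mul, νbar.map_mul]
  congr 1
  induction s using Multiset.induction_on with
  | empty => simp
  | cons b s ih =>
    have hsub : C ((X - C b).eval a) = (X - C b) - (X - C a) := by simp
    rw [Multiset.map_cons, Multiset.prod_cons, eval_mul, C_mul, νbar.map_mul, νbar.map_mul,
      ih fun c hc => ha c (Multiset.mem_cons_of_mem hc), hsub,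
      νbar.map_sub_eq_of_lt_left (ha b (Multiset.mem_cons_self b s))]

theorem coe_le_delta {f : L[X]} {b : L} (hb : b ∈ f.roots) :
    ((νbar (X - C b) : WithTop Γ') : WithBot (WithTop Γ')) ≤ delta νbar f := by
  classical
  exact Finset.le_sup (f := fun a => ((νbar (X - C a) : WithTop Γ') : WithBot (WithTop Γ')))
    (Multiset.mem_toFinset.2 hb)

theorem exists_root_delta_eq {f : L[X]} (hf : f.roots ≠ 0) :
    ∃ a ∈ f.roots, delta νbar f = ((νbar (X - C a) : WithTop Γ') : WithBot (WithTop Γ')) := by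
  classical
  obtain ⟨a, ha, hsup⟩ := Finset.exists_mem_eq_sup f.roots.toFinset
    (Multiset.toFinset_nonempty.2 hf)
    fun a => ((νbar (X - C a) : WithTop Γ') : WithBot (WithTop Γ'))
  exact ⟨a, Multiset.mem_toFinset.1 ha, hsup⟩

variable [Algebra K L] {ν : AddValuation K[X] (WithTop Γ)} {n : ℕ}

theorem Psi.monic (Q : Psi ν νbar n) : Q.poly.Monic :=
  Q.isKeyPoly.1

theorem Psi.degree_eq (Q Q' : Psi ν νbar n) : Q.poly.degree = Q'.poly.degree := by
  rw [degree_eq_natDegree Q.monic.ne_zero, degree_eq_natDegree Q'.monic.ne_zero, Q.natDegree_eq,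
    Q'.natDegree_eq]

variable [IsAlgClosed L] {Q : K[X]}

theorem IsKeyPoly.exists_root (hQ : IsKeyPoly νbar Q) (hdeg : 0 < Q.degree) :
    ∃ a : L, Q.aeval a = 0 ∧ ∀ f : K[X], f.degree < Q.degree →
      νbar (C (f.aeval a)) = νbar (f.map (algebraMap K L)) := by
  have hroots : (Q.map (algebraMap K L)).roots ≠ 0 := by
    rw [Ne, IsAlgClosed.roots_eq_zero_iff_degree_nonpos, degree_map]
    exact hdeg.not_ge
  obtain ⟨a, ha, hdelta⟩ := exists_root_delta_eq (νbar := νbar) hroots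
  refine ⟨a, ?_, fun f hf => ?_⟩
  · rw [← eval_map_algebraMap]
    exact (mem_roots'.1 ha).2
  · rw [← eval_map_algebraMap]
    refine map_C_eval_eq (IsAlgClosed.splits _) fun b hb => WithBot.coe_lt_coe.1 ?_
    have hf0 : f ≠ 0 := by
      rintro rfl
      simp at hb
    calc ((νbar (X - C b) : WithTop Γ') : WithBot (WithTop Γ'))
        ≤ delta νbar (f.map (algebraMap K L)) := coe_le_delta hb
      _ < delta νbar (Q.map (algebraMap K L)) := not_le.1 (mt (hQ.2 f hf0) (not_le.2 hf))
      _ = νbar (X - C a) := hdelta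

theorem IsKeyPoly.isMulModInvariant {e : Γ →+ Γ'}
    (he : Function.Injective e) (hνbar : ∀ f : K[X], νbar (f.map (algebraMap K L)) = (ν f).map e)
    (hQ : IsKeyPoly νbar Q) (hdeg : 0 < Q.degree) : IsMulModInvariant ν Q := by
  refine ⟨hdeg, fun f g hf hg => WithTop.map_injective he ?_⟩
  obtain ⟨a, ha, heval⟩ := hQ.exists_root hdeg
  have hmod : (f * g % Q).aeval a = f.aeval a * g.aeval a := by
    rw [EuclideanDomain.mod_eq_sub_mul_div, map_sub, map_mul, map_mul, ha, zero_mul, sub_zero]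
  rw [← hνbar, ← hνbar, ← heval _ (degree_mod_lt _ (ne_zero_of_degree_gt hdeg)), hmod, C_mul,
    νbar.map_mul, heval f hf, heval g hg, Polynomial.map_mul, νbar.map_mul]

theorem Psi.isMulModInvariant {e : Γ →+ Γ'} (he : Function.Injective e)
    (hνbar : ∀ f : K[X], νbar (f.map (algebraMap K L)) = (ν f).map e) (Q : Psi ν νbar n)
    (hQ : ∃ Q' : Psi ν νbar n, ν Q.poly < ν Q'.poly) : IsMulModInvariant ν Q.poly :=
  let ⟨Q', hlt⟩ := hQ
  Q.isKeyPoly.isMulModInvariant he hνbar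
    (degree_pos_of_map_lt Q.monic Q'.monic (Q.degree_eq Q') hlt)

end KeyPolynomial

section Graded

variable {R Γ : Type*} [CommRing R] [AddCommGroup Γ] [LinearOrder Γ] [IsOrderedAddMonoid Γ]

section GrMap

variable {v w u : AddValuation R (WithTop Γ)}

theorem Piece.mk_eq_zero {γ : Γ} {f : R} (hf : (γ : WithTop Γ) ≤ v f) :
    Piece.mk v f hf = 0 ↔ (γ : WithTop Γ) < v f := by
  rw [Piece.mk_zero, eq_comm, Piece.mk_eq_mk, sub_zero]

theorem of_mk_eq_inForm {γ : Γ} {f : R} (hf : v f = γ) :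
    DirectSum.of (Piece v) γ (Piece.mk v f hf.ge) = inForm v f := by
  have htop : v f ≠ ⊤ := hf ▸ WithTop.coe_ne_top
  rw [inForm, dif_neg htop]
  exact DirectSum.of_eq_of_gradedMonoid_eq
    (Piece.sigma_eq (by simp only [hf, WithTop.untop_coe]) rfl _ _)

theorem inForm_of_eq_top {f : R} (hf : v f = ⊤) : inForm v f = 0 :=
  dif_pos hf

theorem inForm_eq_of_lt {f g : R} (hlt : v f < v (g - f)) : inForm v f = inForm v g := by
  have hg : v g = v f := v.map_eq_of_lt_sub hlt
  obtain ⟨γ, hγ⟩ := WithTop.ne_top_iff_exists.1 (ne_top_of_lt hlt)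
  rw [← of_mk_eq_inForm hγ.symm, ← of_mk_eq_inForm (hg.trans hγ.symm)]
  congr 1
  rwa [Piece.mk_eq_mk, hγ]

theorem closure_range_inForm : AddSubgroup.closure (Set.range (inForm v)) = ⊤ := by
  refine eq_top_iff.2 fun z _ => ?_
  induction z using DirectSum.induction_on with
  | zero => exact zero_mem _
  | add a b ha hb => exact add_mem (ha trivial) (hb trivial)
  | of γ a =>
    obtain ⟨f, hf, rfl⟩ := a.exists_rep
    rcases hf.lt_or_eq with hlt | heq
    · rw [(Piece.mk_eq_zero hf).2 hlt, _root_.map_zero]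
      exact zero_mem _
    · rw [of_mk_eq_inForm heq.symm]
      exact AddSubgroup.subset_closure ⟨f, rfl⟩

theorem grMap_toAddMonoidHom (hvw : ∀ f, v f ≤ w f) :
    (grMap hvw : GrRing v →+ GrRing w) = DirectSum.map (pieceMap hvw) :=
  DirectSum.addHom_ext fun γ a => by
    rw [DirectSum.map_of]
    exact DirectSum.toAddMonoid_of _ γ a

theorem grMap_apply (hvw : ∀ f, v f ≤ w f) (x : GrRing v) (γ : Γ) :
    grMap hvw x γ = pieceMap hvw γ (x γ) := by
  rw [← DirectSum.map_apply, ← grMap_toAddMonoidHom]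
  rfl

theorem grMap_self (hvv : ∀ f, v f ≤ v f) (x : GrRing v) : grMap hvv x = x := by
  refine DFinsupp.ext fun γ => ?_
  obtain ⟨f, hf, hx⟩ := (x γ).exists_rep
  rw [grMap_apply, ← hx, pieceMap_mk]

theorem grMap_grMap (hvw : ∀ f, v f ≤ w f) (hwu : ∀ f, w f ≤ u f) (hvu : ∀ f, v f ≤ u f)
    (x : GrRing v) : grMap hwu (grMap hvw x) = grMap hvu x := by
  refine DFinsupp.ext fun γ => ?_
  obtain ⟨f, hf, hx⟩ := (x γ).exists_rep
  rw [grMap_apply, grMap_apply, grMap_apply, ← hx, pieceMap_mk, pieceMap_mk, pieceMap_mk]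

end GrMap

section DirectLimit

variable {ι : Type*} [Preorder ι] {v : ι → AddValuation R (WithTop Γ)}
  {u : AddValuation R (WithTop Γ)} (mono : ∀ i j, i ≤ j → ∀ f, v i f ≤ v j f)
  (le : ∀ i f, v i f ≤ u f)

theorem grMap_directedSystem :
    DirectedSystem (fun i => GrRing (v i)) fun i j hij => grMap (mono i j hij) where
  map_self _ x := grMap_self _ x
  map_map _ _ _ _ _ x := grMap_grMap _ _ _ x

theorem eventually_pieceMap_eq_zero (exists_lt : ∀ i f, v i f < u f → ∃ j, v i f < v j f)
    {i : ι} {γ : Γ} {a : Piece (v i) γ} (ha : pieceMap (le i) γ a = 0) :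
    ∀ᶠ j in atTop, ∀ hij : i ≤ j, pieceMap (mono i j hij) γ a = 0 := by
  obtain ⟨f, hf, rfl⟩ := a.exists_rep
  rw [pieceMap_mk, Piece.mk_eq_zero] at ha
  obtain ⟨j, hj⟩ : ∃ j, (γ : WithTop Γ) < v j f := by
    rcases hf.lt_or_eq with hlt | heq
    · exact ⟨i, hlt⟩
    · obtain ⟨j, hj⟩ := exists_lt i f (heq ▸ ha)
      exact ⟨j, heq ▸ hj⟩
  filter_upwards [eventually_ge_atTop j] with k hjk hik
  rw [pieceMap_mk, Piece.mk_eq_zero]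
  exact hj.trans_le (mono j k hjk f)

theorem exists_grMap_eq_zero [IsDirectedOrder ι]
    (exists_lt : ∀ i f, v i f < u f → ∃ j, v i f < v j f)
    {i : ι} {x : GrRing (v i)} (hx : grMap (le i) x = 0) :
    ∃ j, ∃ hij : i ≤ j, grMap (mono i j hij) x = 0 := by
  classical
  have : Nonempty ι := ⟨i⟩
  have hpiece : ∀ γ ∈ DFinsupp.support x,
      ∀ᶠ j in atTop, ∀ hij : i ≤ j, pieceMap (mono i j hij) γ (x γ) = 0 := fun γ _ =>
    eventually_pieceMap_eq_zero mono le exists_lt (by rw [← grMap_apply, hx, DirectSum.zero_apply])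
  obtain ⟨j, hij, hj⟩ := ((eventually_ge_atTop i).and
    ((Finset.eventually_all (DFinsupp.support x)).2 hpiece)).exists
  refine ⟨j, hij, DFinsupp.ext fun γ => ?_⟩
  rw [grMap_apply]
  by_cases hγ : γ ∈ DFinsupp.support x
  · exact hj γ hγ hij
  · rw [DFinsupp.notMem_support_iff.1 hγ, _root_.map_zero, DirectSum.zero_apply]

/-- The ring homomorphism `lim 𝒢_{v i} → 𝒢_u` induced by the maps `𝒢_{v i} → 𝒢_u`, for an increasing
family of valuations `v i ≤ u`. -/
def grDirectLimitMap :
    Ring.DirectLimit (fun i => GrRing (v i)) (fun i j hij => grMap (mono i j hij)) →+* GrRing u :=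
  Ring.DirectLimit.lift _ _ _ (fun i => grMap (le i)) fun _ _ _ x => grMap_grMap _ _ _ x

theorem grDirectLimitMap_of (i : ι) (x : GrRing (v i)) :
    grDirectLimitMap mono le (Ring.DirectLimit.of _ _ i x) = grMap (le i) x :=
  Ring.DirectLimit.lift_of ..

variable [Nonempty ι] [IsDirectedOrder ι]

theorem grDirectLimitMap_injective (exists_lt : ∀ i f, v i f < u f → ∃ j, v i f < v j f) :
    Function.Injective (grDirectLimitMap mono le) := by
  refine (injective_iff_map_eq_zero _).2 fun z hz => ?_
  obtain ⟨i, x, rfl⟩ := Ring.DirectLimit.exists_of z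
  rw [grDirectLimitMap_of] at hz
  obtain ⟨j, hij, hx⟩ := exists_grMap_eq_zero mono le exists_lt hz
  rw [← Ring.DirectLimit.of_f hij, hx, _root_.map_zero]

theorem range_grDirectLimitMap :
    (grDirectLimitMap mono le).range.toAddSubgroup =
      AddSubgroup.closure {z | ∃ i f, v i f = u f ∧ inForm u f = z} := by
  apply le_antisymm
  · rintro _ ⟨z, rfl⟩
    obtain ⟨i, x, rfl⟩ := Ring.DirectLimit.exists_of z
    have hx : x ∈ AddSubgroup.closure (Set.range (inForm (v i))) := by
      rw [closure_range_inForm]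
      exact AddSubgroup.mem_top x
    change grDirectLimitMap mono le _ ∈ _
    rw [grDirectLimitMap_of]
    induction hx using AddSubgroup.closure_induction with
    | mem x hx =>
      obtain ⟨f, rfl⟩ := hx
      rw [grMap_inForm]
      split_ifs with hf
      · exact AddSubgroup.subset_closure ⟨i, f, hf, rfl⟩
      · exact zero_mem _
    | zero => rw [_root_.map_zero]; exact zero_mem _
    | add x y _ _ hx hy => rw [map_add]; exact add_mem hx hy
    | neg x _ hx => rw [map_neg]; exact neg_mem hx
  · refine (AddSubgroup.closure_le _).2 ?_
    rintro _ ⟨i, f, hf, rfl⟩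
    refine ⟨Ring.DirectLimit.of _ _ i (inForm (v i) f), ?_⟩
    change grDirectLimitMap mono le _ = _
    rw [grDirectLimitMap_of, grMap_inForm, if_pos hf]

end DirectLimit

end Graded

section LimitPolynomial

variable {K Γ ι : Type*} [Field K] [AddCommGroup Γ] [LinearOrder Γ] [IsOrderedAddMonoid Γ]
  [Preorder ι]

theorem map_eq_of_isUnit {R : Type*} [CommRing R] {v u : AddValuation R (WithTop Γ)}
    (hvu : ∀ f, v f ≤ u f) {f : R} (hf : IsUnit f) : v f = u f := by
  obtain ⟨g, hfg⟩ := hf.exists_right_inv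
  have hadd (w : AddValuation R (WithTop Γ)) : w f + w g = 0 := by
    rw [← w.map_mul, hfg, w.map_one]
  have hg : v g ≠ ⊤ := fun htop => by simpa [htop] using hadd v
  refine (hvu f).antisymm (not_lt.1 fun hlt => ?_)
  exact (WithTop.add_lt_add_of_lt_of_le hg hlt (hvu g)).ne ((hadd v).trans (hadd u).symm)

/-- `q` has the properties of a limit key polynomial for the increasing family of valuations
`v i ≤ ν`: the values `v i q` keep increasing, and no polynomial of degree less than `deg q` has all
its values `v i f` less than `ν f`. -/
structure IsLimitPoly (ν : AddValuation K[X] (WithTop Γ)) (v : ι → AddValuation K[X] (WithTop Γ))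
    (q : K[X]) : Prop where
  mono : ∀ i j, i ≤ j → ∀ f, v i f ≤ v j f
  le : ∀ i f, v i f ≤ ν f
  exists_lt : ∀ i, ∃ j, v i q < v j q
  degree_le : ∀ f, (∀ i, v i f < ν f) → q.degree ≤ f.degree

namespace IsLimitPoly

variable {ν : AddValuation K[X] (WithTop Γ)} {v : ι → AddValuation K[X] (WithTop Γ)} {q : K[X]}

theorem map_lt (h : IsLimitPoly ν v q) (i : ι) : v i q < ν q :=
  let ⟨j, hj⟩ := h.exists_lt i
  hj.trans_le (h.le j q)

theorem degree_pos [Nonempty ι] (h : IsLimitPoly ν v q) : 0 < q.degree := by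
  inhabit ι
  have hlt := h.map_lt default
  have hq : q ≠ 0 := by
    rintro rfl
    simp at hlt
  exact degree_pos_of_ne_zero_of_nonunit hq
    fun hunit => hlt.ne (map_eq_of_isUnit (h.le default) hunit)

theorem ne_zero [Nonempty ι] (h : IsLimitPoly ν v q) : q ≠ 0 :=
  ne_zero_of_degree_gt h.degree_pos

theorem eventually_map_eq (h : IsLimitPoly ν v q) {f : K[X]} (hf : f.degree < q.degree) :
    ∀ᶠ i in atTop, v i f = ν f := by
  obtain ⟨i, hi⟩ : ∃ i, ν f ≤ v i f := by
    by_contra! hlt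
    exact hf.not_ge (h.degree_le f hlt)
  filter_upwards [eventually_ge_atTop i] with j hij
  exact (h.le j f).antisymm (hi.trans (h.mono i j hij f))

theorem exists_map_mul_lt [IsDirectedOrder ι] (h : IsLimitPoly ν v q) {i : ι} {g : K[X]}
    (hg : v i (q * g) ≠ ⊤) : ∃ j ≥ i, v i (q * g) < v j (q * g) := by
  obtain ⟨k, hk⟩ := h.exists_lt i
  obtain ⟨j, hij, hkj⟩ := exists_ge_ge i k
  refine ⟨j, hij, ?_⟩
  rw [(v i).map_mul, (v j).map_mul]
  refine WithTop.add_lt_add_of_lt_of_le (fun htop => hg ?_) (hk.trans_le (h.mono k j hkj q))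
    (h.mono i j hij g)
  rw [(v i).map_mul, htop, add_top]

variable [Nonempty ι] [IsDirectedOrder ι]

theorem isMulModInvariant (h : IsLimitPoly ν v q) : IsMulModInvariant ν q := by
  refine ⟨h.degree_pos, fun f g hf hg => by_contra fun hne => ?_⟩
  obtain ⟨i, hfi, hgi, hmod⟩ := ((h.eventually_map_eq hf).and ((h.eventually_map_eq hg).and
    (h.eventually_map_eq (degree_mod_lt (f * g) h.ne_zero)))).exists
  have hmul : v i (f * g) = ν (f * g) := by rw [(v i).map_mul, ν.map_mul, hfi, hgi]
  have map_eq_min {u : AddValuation K[X] (WithTop Γ)} (hu : u (f * g % q) ≠ u (f * g)) :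
      u (q * (f * g / q)) = min (u (f * g)) (u (f * g % q)) := by
    rw [mul_div_eq_sub_mod, sub_eq_add_neg, u.map_add_of_distinct_val, u.map_neg]
    rwa [u.map_neg, ne_comm]
  -- The minimum is taken over values that are already final, whereas `v i (q * _)` never is.
  have heq : v i (q * (f * g / q)) = ν (q * (f * g / q)) := by
    rw [map_eq_min hne, map_eq_min (by rwa [hmul, hmod]), hmul, hmod]
  have htop : v i (q * (f * g / q)) ≠ ⊤ := fun htop => by
    rw [heq, map_eq_min hne, min_eq_top] at htop
    exact hne (htop.2.trans htop.1.symm)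
  obtain ⟨j, -, hj⟩ := h.exists_map_mul_lt htop
  exact ((h.le j _).trans_eq heq.symm).not_gt hj

theorem map_le_map_mod (h : IsLimitPoly ν v q) (i : ι) (f : K[X]) : v i f ≤ ν (f % q) := by
  by_contra! hlt
  obtain ⟨j, hij, hmod⟩ := ((eventually_ge_atTop i).and
    (h.eventually_map_eq (degree_mod_lt f h.ne_zero))).exists
  have hmul : v j (q * (f / q)) = ν (f % q) := by
    rw [mul_div_eq_sub_mod, (v j).map_sub_eq_of_lt_right, hmod]
    exact hmod ▸ hlt.trans_le (h.mono i j hij f)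
  obtain ⟨k, hjk, hk⟩ := h.exists_map_mul_lt (hmul ▸ hlt.ne_top)
  have hmod_eq : f % q = f + -(q * (f / q)) := by
    rw [EuclideanDomain.mod_eq_sub_mul_div, sub_eq_add_neg]
  have hmod_lt : ν (f % q) < v k (f % q) := by
    conv_rhs => rw [hmod_eq]
    exact (v k).map_lt_add (hlt.trans_le (h.mono i k (hij.trans hjk) f))
      (by rwa [(v k).map_neg, ← hmul])
  exact (h.le k (f % q)).not_gt hmod_lt

theorem exists_map_le_map_mul_div (h : IsLimitPoly ν v q) (i : ι) (f : K[X]) :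
    ∃ j, v j (f % q) = ν (f % q) ∧ v i f ≤ v j (q * (f / q)) := by
  obtain ⟨j, hij, hmod⟩ := ((eventually_ge_atTop i).and
    (h.eventually_map_eq (degree_mod_lt f h.ne_zero))).exists
  refine ⟨j, hmod, ?_⟩
  rw [mul_div_eq_sub_mod]
  exact (v j).map_le_sub (h.mono i j hij f) (hmod ▸ h.map_le_map_mod i f)

theorem map_le_truncation (h : IsLimitPoly ν v q) (i : ι) (f : K[X]) :
    v i f ≤ truncation ν q f := by
  induction f using div_induction h.degree_pos generalizing i with
  | of_degree_lt f hf => rw [truncation_of_degree_lt h.degree_pos hf]; exact h.le i f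
  | of_div f ih =>
    rw [truncation_eq_min h.degree_pos]
    refine le_min (h.map_le_map_mod i f) ?_
    obtain ⟨j, -, hmul⟩ := h.exists_map_le_map_mul_div i f
    calc v i f ≤ v j (f / q) + v j q := by rwa [add_comm, ← (v j).map_mul]
      _ ≤ truncation ν q (f / q) + ν q := add_le_add (ih j) (h.le j q)

theorem exists_map_lt (h : IsLimitPoly ν v q) {i : ι} {f : K[X]}
    (hf : v i f < truncation ν q f) : ∃ j, v i f < v j f := by
  obtain ⟨j, hmod, hmul⟩ := h.exists_map_le_map_mul_div i f
  have hmod_lt : v i f < v j (f % q) :=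
    hmod ▸ hf.trans_le (truncation_le_map_mod h.degree_pos f)
  obtain ⟨k, hjk, hk⟩ : ∃ k ≥ j, v i f < v k (q * (f / q)) := by
    by_cases htop : v j (q * (f / q)) = ⊤
    · exact ⟨j, le_rfl, htop ▸ hf.trans_le le_top⟩
    · obtain ⟨k, hjk, hk⟩ := h.exists_map_mul_lt htop
      exact ⟨k, hjk, hmul.trans_lt hk⟩
  refine ⟨k, ?_⟩
  conv_rhs => rw [← EuclideanDomain.div_add_mod f q]
  exact (v k).map_lt_add hk (hmod_lt.trans_le (h.mono j k hjk _))

theorem lt_truncation_mul_div (h : IsLimitPoly ν v q) {i : ι} {f : K[X]}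
    (hf : v i f = truncation ν q f) (htop : truncation ν q f ≠ ⊤) :
    truncation ν q f < truncation ν q (q * (f / q)) := by
  obtain ⟨j, -, hmul⟩ := h.exists_map_le_map_mul_div i f
  rw [← hf] at htop ⊢
  by_cases hdiv : v j (q * (f / q)) = ⊤
  · exact (lt_top_iff_ne_top.2 htop).trans_le (hdiv ▸ h.map_le_truncation j _)
  · obtain ⟨k, -, hk⟩ := h.exists_map_mul_lt hdiv
    exact (hmul.trans_lt hk).trans_le (h.map_le_truncation k _)

theorem closure_inForm_eq (h : IsLimitPoly ν v q) (w : TruncVal ν q) :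
    AddSubgroup.closure {z | ∃ i f, v i f = w.val f ∧ inForm w.val f = z} = w.R := by
  refine le_antisymm ((AddSubgroup.closure_le _).2 ?_) (AddSubgroup.closure_mono ?_)
  · rintro _ ⟨i, f, hf, rfl⟩
    by_cases htop : w.val f = ⊤
    · rw [inForm_of_eq_top htop]
      exact zero_mem _
    · have hlt : w.val f < w.val (f % q - f) := by
        rw [← neg_sub, ← mul_div_eq_sub_mod, w.val.map_neg, w.val_eq, w.val_eq]
        exact h.lt_truncation_mul_div (w.val_eq f ▸ hf) (w.val_eq f ▸ htop)
      rw [inForm_eq_of_lt hlt]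
      exact AddSubgroup.subset_closure ⟨_, degree_mod_lt f h.ne_zero, rfl⟩
  · rintro _ ⟨f, hf, rfl⟩
    obtain ⟨i, hi⟩ := (h.eventually_map_eq hf).exists
    exact ⟨i, f, by rw [hi, w.val_of_degree_lt h.degree_pos hf], rfl⟩

theorem exists_subring_ringEquiv (h : IsLimitPoly ν v q) (w : TruncVal ν q) :
    ∃ S : Subring w.Gr, S.toAddSubgroup = w.R ∧
      Nonempty (Ring.DirectLimit (fun i => GrRing (v i))
        (fun i j hij => grMap (h.mono i j hij)) ≃+* S) := by
  have le (i : ι) (f : K[X]) : v i f ≤ w.val f := w.val_eq f ▸ h.map_le_truncation i f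
  have injective : Function.Injective (grDirectLimitMap h.mono le) :=
    grDirectLimitMap_injective h.mono le fun i f hf => h.exists_map_lt (w.val_eq f ▸ hf)
  refine ⟨(grDirectLimitMap h.mono le).range, ?_, ⟨?_⟩⟩
  · rw [range_grDirectLimitMap, h.closure_inForm_eq]
  · exact RingEquiv.ofBijective _
      ⟨fun _ _ hab => injective (congrArg Subtype.val hab), RingHom.rangeRestrict_surjective _⟩

end IsLimitPoly

end LimitPolynomial

section TruncationFamily

variable {K Γ ι : Type*} [Field K] [AddCommGroup Γ] [LinearOrder Γ] [IsOrderedAddMonoid Γ]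
  {ν : AddValuation K[X] (WithTop Γ)}

variable [Preorder ι] {P : ι → K[X]}
  (hle : ∀ i j, i ≤ j ↔ ∀ f, truncation ν (P i) f ≤ truncation ν (P j) f)
  (hP : ∀ i, (P i).Monic) (hdeg : ∀ i j, (P i).degree = (P j).degree)
  (hpos : ∀ i, 0 < (P i).degree) (w : ∀ i, TruncVal ν (P i))

include hle hP hdeg hpos w

theorem isDirectedOrder_of_truncation : IsDirectedOrder ι where
  directed i j := by
    have le_of_map_le {i j : ι} (hij : ν (P i) ≤ ν (P j)) : i ≤ j :=
      (hle i j).2 (truncation_le_truncation (w j) (hpos j) (hP i) (hP j) (hdeg i j) hij)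
    rcases le_total (ν (P i)) (ν (P j)) with hij | hji
    · exact ⟨j, le_of_map_le hij, le_rfl⟩
    · exact ⟨i, le_rfl, le_of_map_le hji⟩

theorem isLimitPoly_of_truncation (hmax : ∀ i, ∃ j, ν (P i) < ν (P j)) {q : K[X]}
    (hlt : ∀ i, truncation ν (P i) q < ν q)
    (hmin : ∀ f, (∀ i, truncation ν (P i) f < ν f) → q.degree ≤ f.degree) :
    IsLimitPoly ν (fun i => (w i).val) q where
  mono i j hij f := by
    rw [(w i).val_eq, (w j).val_eq]
    exact (hle i j).1 hij f
  le i f := (w i).val_eq f ▸ truncation_le (hpos i) f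
  exists_lt i := by
    obtain ⟨j, hij⟩ := hmax i
    refine ⟨j, ?_⟩
    rw [(w i).val_eq, (w j).val_eq]
    exact truncation_lt_truncation (w i) (w j) (hpos j) (hP i) (hP j) (hdeg i j) hij (hlt i)
  degree_le f hf := hmin f fun i => (w i).val_eq f ▸ hf i

end TruncationFamily

end KeyPoly

end

theorem mainTheorem3_general {K Γ ι : Type*} [Field K]
    [AddCommGroup Γ] [LinearOrder Γ] [IsOrderedAddMonoid Γ] [Preorder ι] [Nonempty ι]
    (ν : AddValuation K[X] (WithTop Γ)) (P : ι → K[X]) (w : ∀ i, TruncVal ν (P i))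
    (hP : ∀ i, (P i).Monic) (hdeg : ∀ i j, (P i).degree = (P j).degree)
    (hle : ∀ i j, i ≤ j ↔ ∀ f, truncation ν (P i) f ≤ truncation ν (P j) f)
    (hmax : ∀ i, ∃ j, ν (P i) < ν (P j))
    (q : K[X]) (hlt : ∀ i, truncation ν (P i) q < ν q)
    (hmin : ∀ f, (∀ i, truncation ν (P i) f < ν f) → q.degree ≤ f.degree) :
    ∃ wn : TruncVal ν q,
      IsDirectedOrder ι ∧
      DirectedSystem (fun i => (w i).Gr) (fun i j h => (w i).phi (w j) ((hle i j).1 h)) ∧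
      ∃ S : Subring wn.Gr, S.toAddSubgroup = wn.R ∧
        Nonempty (Ring.DirectLimit (fun i => (w i).Gr)
          (fun i j h => (w i).phi (w j) ((hle i j).1 h)) ≃+* S) := by
  have hpos (i : ι) : 0 < (P i).degree :=
    let ⟨j, hij⟩ := hmax i
    degree_pos_of_map_lt (hP i) (hP j) (hdeg i j) hij
  have hdirected : IsDirectedOrder ι := isDirectedOrder_of_truncation hle hP hdeg hpos w
  have hlimit : IsLimitPoly ν (fun i => (w i).val) q :=
    isLimitPoly_of_truncation hle hP hdeg hpos w hmax hlt hmin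
  exact ⟨hlimit.isMulModInvariant.truncVal, hdirected, grMap_directedSystem hlimit.mono,
    hlimit.exists_subring_ringEquiv _⟩

theorem mainTheorem3 {K L Γ Γ' : Type*} [Field K] [Field L] [Algebra K L] [IsAlgClosure K L]
    [AddCommGroup Γ] [LinearOrder Γ] [IsOrderedAddMonoid Γ]
    [AddCommGroup Γ'] [LinearOrder Γ'] [IsOrderedAddMonoid Γ']
    (ν : AddValuation K[X] (WithTop Γ))
    -- an extension of `ν` to `L[x]`, with values in an ordered group that contains `Γ`
    (e : Γ →+ Γ') (he : StrictMono e) (νbar : AddValuation L[X] (WithTop Γ'))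
    (hνbar : ∀ f : K[X], νbar (f.map (algebraMap K L)) = (ν f).map e)
    (n : ℕ) (hne : Nonempty (Psi ν νbar n))
    (hmax : ∀ Q : Psi ν νbar n, ∃ Q' : Psi ν νbar n, ν Q.poly < ν Q'.poly)
    (Qn : K[X]) (hQn : IsLimitKeyPoly ν νbar n Qn) :
    ∃ (w : ∀ Q : Psi ν νbar n, TruncVal ν Q.poly) (wn : TruncVal ν Qn),
      IsDirectedOrder (Psi ν νbar n) ∧
      DirectedSystem (fun Q => (w Q).Gr) (fun Q Q' h => (w Q).phi (w Q') h) ∧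
      ∃ S : Subring wn.Gr, S.toAddSubgroup = wn.R ∧
        Nonempty (Ring.DirectLimit (fun Q => (w Q).Gr)
          (fun Q Q' h => (w Q).phi (w Q') h) ≃+* S) := by
  have : IsAlgClosed L := IsAlgClosure.isAlgClosed K
  exact ⟨fun Q => (Psi.isMulModInvariant he.injective hνbar Q (hmax Q)).truncVal,
    mainTheorem3_general ν Psi.poly _ Psi.monic Psi.degree_eq (fun _ _ => Iff.rfl) hmax Qn
      hQn.2.1 hQn.2.2⟩
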